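/- Let $\beta>1$ be a Pisot number of degree $d\ge 2$ (a real algebraic integer all of whose other conjugates have modulus $<1$), with minimal polynomial $P_\beta(X)=X^d+p_{d-1}X^{d-1}+\dots+p_0\in\mathbb Z[X]$. *Parry polynomial.* Let $T_\beta(x)=\{\beta x\}$, $t_i=\lfloor \beta T_\beta^{i-1}(1)\rfloor$ for $i\ge 1$, and $R_n(X)=X^n-t_1X^{n-1}-\dots-t_n$. The number $\beta$ is a Parry number if the sequence $(t_i)_{i\ge1}$ is eventually periodic (possibly eventually zero). If it is eventually zero with last non-zero digit $t_m$, put $n_\beta^*=R_m$; otherwise put $n^*_\beta=R_{m+q}-R_m$, where $m\ge 0$ is the (least) preperiod length and $q\ge 1$ the (least) period length. The polynomial $n_\beta^*$ is the Parry polynomial of $\beta$, $d_P$ is its degree, and $\mathrm H(n_\beta^*)$ is its height, the maximum of the absolute values of its coefficients. *Cut-and-project scheme.* Let $Z_0,\dots,Z_{d-1}$ be the canonical basis of $\mathbb R^d$, $\cdot$ the standard scalar product, $\|\cdot\|$ the Euclidean norm, $B=(1,\beta,\dots,\beta^{d-1})$, $u_B=B/\|B\|$, and $\pi_B$ the orthogonal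 projection onto $\mathbb R u_B$. Let ${}^tQ$ be the companion matrix with ${}^tQ Z_j=Z_{j+1}$ for $0\le j<d-1$ and ${}^tQ Z_{d-1}=-\sum_{i<d}p_iZ_i$. Its eigenvalues are the conjugates of $\beta$. For every conjugate $\alpha\ne\beta$, taken up to complex conjugation, let $F=F_\alpha$ be the ${}^tQ$-invariant real subspace with eigenvalue(s) $\alpha,\bar\alpha$, of dimension $1$ if $\alpha$ is real and $2$ otherwise. Let $\pi_F:\mathbb R^d\to F$ be the projection along the ${}^tQ$-invariant complement of $F$, let $p_2=\sum_F\pi_F$, and let $\lambda_F=|\alpha|<1$. If $\dim F=1$, let $\|\cdot\|_F$ be the Euclidean norm on $F$. If $\dim F=2$, let $\|v\|_F=\bigl|\sum_{j}v_j\alpha^j\bigr|$, the norm on $F$, unique up to a scalar factor among those coming from a scalar product, for which ${}^tQ$ acts on $F$ as a similarity, of ratio $\lambda_F$. (Multiplying $\|\cdot\|_F$ by a positive constant does not change the window below.) Put $$\mathcal C'=\Bigl\{\sum_{j}a_jZ_j : a_j\in[-1,1]\Bigr\},\qquad \delta'_F=\max_{x\in\mathcal C'}\|\pi_F(x)\|_F,\qquad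 c'_F=\lfloor\beta\rfloor\,\frac{\delta'_F}{1-\lambda_F^d},$$ $$\Omega'_F=\{v\in F:\|v\|_F\le c'_F\},\qquad \Omega'=\bigoplus_F\Omega'_F .$$ **Theorem.** The number $\beta$ is a Parry number, the set on the right below is finite, and $$d_P\le \#\Bigl\{x\in\mathbb Z^d \;:\; p_2(x)\in\frac{\mathrm H(n_\beta^*)}{\lfloor\beta\rfloor}\,\Omega',\quad \pi_B(x)\cdot u_B\in\Bigl[0,\frac1{\|B\|}\Bigr)\Bigr\}.$$ -/

import Mathlib

open scoped Pointwise

noncomputable section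

namespace BetaExpansion

open Polynomial

/-! ### Pisot numbers, Rényi expansions, Parry polynomials -/

/-- `β` is a Pisot number: a real algebraic integer `> 1` all of whose other (complex) conjugates
have modulus `< 1`. -/
def IsPisot (β : ℝ) : Prop :=
  IsIntegral ℤ β ∧ 1 < β ∧ ∀ z ∈ (minpoly ℤ β).aroots ℂ, z ≠ (β : ℂ) → ‖z‖ < 1

/-- The degree `d` of the algebraic integer `β`. -/
def deg (β : ℝ) : ℕ := (minpoly ℤ β).natDegree

/-- The `β`-transformation `T_β(x) = {β x}`. -/
def betaT (β x : ℝ) : ℝ := Int.fract (β * x)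

/-- The digits of the Rényi `β`-expansion of `1`, `d_β(1) = 0.t₁ t₂ t₃ …`, numbered from `0`:
`digit β i` is `t_{i+1} = ⌊β T_β^i(1)⌋`. -/
def digit (β : ℝ) (i : ℕ) : ℤ := ⌊β * (betaT β)^[i] 1⌋

/-- `d_β(1)` is finite, that is, it ends in infinitely many zeros. -/
def IsSimpleParry (β : ℝ) : Prop := ∃ n, ∀ i, n ≤ i → digit β i = 0

/-- `β` is a Parry number: `d_β(1)` is eventually periodic (this includes the finite case). -/
def IsParry (β : ℝ) : Prop := ∃ n q, 1 ≤ q ∧ ∀ i, n ≤ i → digit β (i + q) = digit β i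

/-- For a finite expansion `d_β(1) = 0.t₁ … t_m` with `t_m ≠ 0`, the number `m`. -/
def expansionLength (β : ℝ) : ℕ := sInf {n | ∀ i, n ≤ i → digit β i = 0}

/-- The (least) preperiod length of an eventually periodic `d_β(1)`. -/
def preperiod (β : ℝ) : ℕ :=
  sInf {n | ∃ q, 1 ≤ q ∧ ∀ i, n ≤ i → digit β (i + q) = digit β i}

/-- The (least) period length of an eventually periodic `d_β(1)`. -/
def period (β : ℝ) : ℕ :=
  sInf {q | 1 ≤ q ∧ ∀ i, preperiod β ≤ i → digit β (i + q) = digit β i}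

/-- `X^n - t₁ X^(n-1) - … - t_n`, whose value at `β` is `T_β^n(1)`. -/
def remainderPoly (β : ℝ) (n : ℕ) : ℤ[X] :=
  X ^ n - ∑ i ∈ Finset.range n, C (digit β i) * X ^ (n - 1 - i)

open Classical in
/-- The Parry polynomial of a Parry number `β`. If `d_β(1) = 0.t₁ … t_m` is finite it is
`X^m - t₁ X^(m-1) - … - t_m`. Otherwise, with preperiod length `m` and period length `q`, it is
`(X^(m+q) - t₁ X^(m+q-1) - … - t_(m+q)) - (X^m - t₁ X^(m-1) - … - t_m)`. -/
def parryPoly (β : ℝ) : ℤ[X] :=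
  if IsSimpleParry β then remainderPoly β (expansionLength β)
  else remainderPoly β (preperiod β + period β) - remainderPoly β (preperiod β)

/-! ### The cut-and-project scheme -/

/-- `ℝ^d` with its standard scalar product. -/
abbrev Space (β : ℝ) : Type := EuclideanSpace ℝ (Fin (deg β))

/-- The vector `B = (1, β, …, β^(d-1))`. -/
def vecB (β : ℝ) : Space β := WithLp.toLp 2 fun j => β ^ (j : ℕ)

/-- `u_B = B / ‖B‖`. -/
def unitB (β : ℝ) : Space β := ‖vecB β‖⁻¹ • vecB β

/-- The orthogonal projection `π_B` onto the line `ℝ u_B`. -/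
def projB (β : ℝ) : Space β →L[ℝ] Space β :=
  (Submodule.span ℝ {unitB β}).starProjection

/-- The companion matrix `ᵗQ` of `β` acting on column vectors: for the canonical basis
`Z_0, …, Z_(d-1)` it sends `Z_j` to `Z_(j+1)` for `j < d - 1`, and `Z_(d-1)` to
`-∑ p_i Z_i`, where `X^d + ∑_{i<d} p_i X^i` is the minimal polynomial of `β`. Equivalently it is
the matrix of multiplication by `β` in the basis `1, β, …, β^(d-1)`. -/
def companionMatrix (β : ℝ) : Matrix (Fin (deg β)) (Fin (deg β)) ℝ :=
  Matrix.of fun i j =>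
    if (j : ℕ) + 1 = deg β then -((minpoly ℤ β).coeff i : ℝ)
    else if (i : ℕ) = (j : ℕ) + 1 then 1 else 0

/-- The linear map of `ℝ^d` given by the companion matrix. -/
def companionMap (β : ℝ) : Space β →ₗ[ℝ] Space β := Matrix.toEuclideanLin (companionMatrix β)

/-- The conjugates of `β` other than `β` itself, one from each pair of complex conjugate ones.
They index the invariant subspaces `F` of `ᵗQ` of dimension `1` or `2` other than the expanding
line. -/
def innerConj (β : ℝ) : Finset ℂ :=
  {z ∈ ((minpoly ℤ β).aroots ℂ).toFinset | z ≠ (β : ℂ) ∧ 0 ≤ z.im}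

/-- The invariant subspace `F` of `ᵗQ` attached to the conjugate `α`: the kernel of `q(ᵗQ)`, where
`q` is the minimal polynomial of `α` over `ℝ` (`X - α` when `α` is real, and
`(X - α)(X - conj α)` otherwise). -/
def invSubspace (β : ℝ) (α : ℂ) : Submodule ℝ (Space β) :=
  LinearMap.ker (aeval (companionMap β) (minpoly ℝ α))

/-- The invariant subspace of `ᵗQ` complementary to `invSubspace β α`: the range of `q(ᵗQ)`. -/
def invComplement (β : ℝ) (α : ℂ) : Submodule ℝ (Space β) :=
  LinearMap.range (aeval (companionMap β) (minpoly ℝ α))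

open Classical in
/-- The projection `π_F` onto `F` along its invariant complement. (For every conjugate `α` of an
algebraic integer `β` the two subspaces are complementary, see `isCompl_invSubspace` below.) -/
def projF (β : ℝ) (α : ℂ) : Space β →ₗ[ℝ] Space β :=
  if h : IsCompl (invSubspace β α) (invComplement β α) then
    (invSubspace β α).projection (invComplement β α) h
  else 0

/-- The internal projection `p₂ = ⊕_F π_F`. -/
def internalProj (β : ℝ) : Space β →ₗ[ℝ] Space β := ∑ α ∈ innerConj β, projF β α

open Classical in
/-- The norm on the invariant subspace `F` attached to `α`. If `α` is real, `F` is a line with the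
standard norm. If `α` is not real, the plane `F` is identified with `ℂ` through
`v ↦ ∑ v_j α^j`, which turns the action of `ᵗQ` on `F` into the multiplication by `α` (see
`normF_companionMap` below); up to a scalar factor, it is the only norm coming from a scalar
product on `F` for which `ᵗQ` acts on `F` as a similarity, of ratio `λ_F = |α|`. -/
def normF (β : ℝ) (α : ℂ) (v : Space β) : ℝ :=
  if α.im = 0 then ‖v‖ else ‖∑ j, ((v j : ℝ) : ℂ) * α ^ (j : ℕ)‖

/-- The cube `𝒞' = {∑ α_j Z_j | α_j ∈ [-1, 1]}`. -/
def cube (β : ℝ) : Set (Space β) := {x | ∀ j, x j ∈ Set.Icc (-1 : ℝ) 1}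

/-- `δ'_F = max_{x ∈ 𝒞'} ‖π_F(x)‖` (a maximum, by compactness of the cube). -/
def deltaF (β : ℝ) (α : ℂ) : ℝ := sSup ((fun x => normF β α (projF β α x)) '' cube β)

/-- `c'_F = ⌊β⌋ δ'_F / (1 - λ_F^d)`, with `λ_F = |α|`. -/
def radiusF (β : ℝ) (α : ℂ) : ℝ := (⌊β⌋ : ℝ) * (deltaF β α / (1 - ‖α‖ ^ deg β))

/-- The window `Ω'_F`: the closed interval or disk in `F` centred at `0` of radius `c'_F`. -/
def windowF (β : ℝ) (α : ℂ) : Set (Space β) :=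
  {v | v ∈ invSubspace β α ∧ normF β α v ≤ radiusF β α}

/-- The window `Ω' = ⊕_F Ω'_F`. -/
def window (β : ℝ) : Set (Space β) :=
  {v | ∃ w : ℂ → Space β, (∀ α ∈ innerConj β, w α ∈ windowF β α) ∧ v = ∑ α ∈ innerConj β, w α}

/-- A point of the lattice `ℤ^d`, seen in `ℝ^d`. -/
def latticePoint (β : ℝ) (x : Fin (deg β) → ℤ) : Space β := WithLp.toLp 2 fun j => (x j : ℝ)

/-- The points `x ∈ ℤ^d` with `p₂(x) ∈ (H(n*_β) / ⌊β⌋) Ω'` and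
`π_B(x) · u_B ∈ [0, 1/‖B‖)`. The height of an integer polynomial is its `supNorm`, the largest
absolute value of a coefficient. -/
def cutPoints (β : ℝ) : Set (Fin (deg β) → ℤ) :=
  {x | internalProj β (latticePoint β x) ∈ ((parryPoly β).supNorm / (⌊β⌋ : ℝ)) • window β ∧
    inner ℝ (projB β (latticePoint β x)) (unitB β) ∈ Set.Ico 0 (1 / ‖vecB β‖)}

/-! ### The definitions make sense -/

theorem companionMap_apply (β : ℝ) (v : Space β) (i : Fin (deg β)) :
    companionMap β v i = ∑ j, companionMatrix β i j * v j := rfl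

theorem companionMap_basis (β : ℝ) (j i : Fin (deg β)) :
    companionMap β (EuclideanSpace.single j 1) i = companionMatrix β i j := by
  rw [companionMap_apply]
  simp

/-- Multiplication by `X` modulo the minimal polynomial: for every root `z` of the minimal
polynomial, `v ↦ ∑ v_j z^j` turns the companion map into the multiplication by `z`. -/
theorem coord_companionMap (β : ℝ) (hβ : IsIntegral ℤ β) (z : ℂ)
    (hz : aeval z (minpoly ℤ β) = 0) (v : Space β) :
    ∑ i, ((companionMap β v i : ℝ) : ℂ) * z ^ (i : ℕ) =
      z * ∑ j, ((v j : ℝ) : ℂ) * z ^ (j : ℕ) := by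
  have hcol : ∀ j : Fin (deg β),
      ∑ i, ((companionMatrix β i j : ℝ) : ℂ) * z ^ (i : ℕ) = z ^ ((j : ℕ) + 1) := by
    intro j
    by_cases hj : (j : ℕ) + 1 = deg β
    · have h1 := hz
      rw [aeval_eq_sum_range, Finset.sum_range_succ, (minpoly.monic hβ).coeff_natDegree,
        ← Fin.sum_univ_eq_sum_range
          (fun i => (minpoly ℤ β).coeff i • z ^ i) (minpoly ℤ β).natDegree] at h1
      rw [hj]
      simp only [companionMatrix, Matrix.of_apply, hj, if_true]
      push_cast
      simp only [neg_mul, Finset.sum_neg_distrib]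
      simp only [zsmul_eq_mul, Int.cast_one, one_mul] at h1
      exact neg_eq_of_add_eq_zero_right h1
    · have hlt : (j : ℕ) + 1 < deg β := by omega
      rw [Finset.sum_eq_single (⟨(j : ℕ) + 1, hlt⟩ : Fin (deg β))]
      · simp [companionMatrix, hj]
      · intro b _ hb
        have : (b : ℕ) ≠ (j : ℕ) + 1 := fun h => hb (Fin.ext h)
        simp [companionMatrix, hj, this]
      · simp
  calc ∑ i, ((companionMap β v i : ℝ) : ℂ) * z ^ (i : ℕ)
      = ∑ i, ∑ j, ((companionMatrix β i j : ℝ) : ℂ) * z ^ (i : ℕ) * (v j : ℂ) := by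
        refine Finset.sum_congr rfl fun i _ => ?_
        rw [companionMap_apply]
        push_cast
        rw [Finset.sum_mul]
        exact Finset.sum_congr rfl fun j _ => by ring
    _ = ∑ j, (∑ i, ((companionMatrix β i j : ℝ) : ℂ) * z ^ (i : ℕ)) * (v j : ℂ) := by
        rw [Finset.sum_comm]
        exact Finset.sum_congr rfl fun j _ => by rw [Finset.sum_mul]
    _ = z * ∑ j, ((v j : ℝ) : ℂ) * z ^ (j : ℕ) := by
        rw [Finset.mul_sum]
        refine Finset.sum_congr rfl fun j _ => ?_
        rw [hcol]
        ring

/-- The minimal polynomial of `β` annihilates the companion map. -/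
theorem aeval_companionMap (β : ℝ) (hβ : IsIntegral ℤ β) :
    aeval (companionMap β) ((minpoly ℤ β).map (Int.castRingHom ℝ)) = 0 := by
  have hd : 0 < deg β := minpoly.natDegree_pos hβ
  set T := companionMap β with hT
  set Z : Fin (deg β) → Space β := fun j => EuclideanSpace.single j 1 with hZ
  have hpow : ∀ k (hk : k < deg β), (T ^ k) (Z ⟨0, hd⟩) = Z ⟨k, hk⟩ := by
    intro k
    induction k with
    | zero => intro hk; simp
    | succ k ih =>
      intro hk
      rw [pow_succ', Module.End.mul_apply, ih (by omega)]
      ext i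
      rw [hT, hZ, companionMap_basis]
      have h1 : k + 1 ≠ deg β := by omega
      simp only [companionMatrix, Matrix.of_apply, h1, if_false, PiLp.single_apply, Fin.ext_iff]
  have hlast : (T ^ deg β) (Z ⟨0, hd⟩) =
      -∑ i : Fin (deg β), ((minpoly ℤ β).coeff i : ℝ) • Z i := by
    have hk : deg β - 1 < deg β := by omega
    have he : deg β = (deg β - 1) + 1 := by omega
    have h1 : (T ^ deg β) (Z ⟨0, hd⟩) = T (Z ⟨deg β - 1, hk⟩) := by
      rw [← hpow _ hk, ← Module.End.mul_apply, ← pow_succ']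
      exact congrArg (fun n => (T ^ n) (Z ⟨0, hd⟩)) he
    rw [h1]
    ext i
    rw [hT, hZ, companionMap_basis]
    have h2 : deg β - 1 + 1 = deg β := by omega
    simp [companionMatrix, h2, Finset.sum_apply, Pi.single_apply]
  have h0 : aeval T ((minpoly ℤ β).map (Int.castRingHom ℝ)) (Z ⟨0, hd⟩) = 0 := by
    rw [aeval_eq_sum_range, natDegree_map_eq_of_injective Int.cast_injective,
      Finset.sum_range_succ, LinearMap.add_apply, LinearMap.sum_apply]
    have hlc : (minpoly ℤ β).coeff (minpoly ℤ β).natDegree = 1 :=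
      (minpoly.monic hβ).coeff_natDegree
    rw [coeff_map, hlc, map_one, one_smul]
    change _ + (T ^ deg β) (Z ⟨0, hd⟩) = 0
    rw [hlast, ← Fin.sum_univ_eq_sum_range (fun k =>
      (((minpoly ℤ β).map (Int.castRingHom ℝ)).coeff k • T ^ k) (Z ⟨0, hd⟩))
        (minpoly ℤ β).natDegree, add_neg_eq_zero]
    refine Finset.sum_congr rfl fun i _ => ?_
    rw [LinearMap.smul_apply, hpow _ i.2, coeff_map]
    rfl
  refine (EuclideanSpace.basisFun (Fin (deg β)) ℝ).toBasis.ext fun j => ?_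
  have hj : (EuclideanSpace.basisFun (Fin (deg β)) ℝ).toBasis j = (T ^ (j : ℕ)) (Z ⟨0, hd⟩) := by
    rw [hpow _ j.2]
    simp [hZ]
  have hcomm : aeval T ((minpoly ℤ β).map (Int.castRingHom ℝ)) * T ^ (j : ℕ) =
      T ^ (j : ℕ) * aeval T ((minpoly ℤ β).map (Int.castRingHom ℝ)) := by
    rw [← aeval_X_pow (R := ℝ) T, ← aeval_mul, ← aeval_mul, mul_comm]
  rw [hj, LinearMap.zero_apply, ← Module.End.mul_apply, hcomm, Module.End.mul_apply, h0, map_zero]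

/-- The two invariant subspaces attached to a conjugate of `β` are complementary. -/
theorem isCompl_invSubspace (β : ℝ) (hβ : IsIntegral ℤ β) (α : ℂ)
    (hα : α ∈ (minpoly ℤ β).aroots ℂ) : IsCompl (invSubspace β α) (invComplement β α) := by
  set P := (minpoly ℤ β).map (Int.castRingHom ℝ) with hP
  have hα0 : aeval α P = 0 := by
    have h := aeval_map_algebraMap ℝ α (minpoly ℤ β)
    rw [(mem_aroots.1 hα).2] at h
    exact h
  have hsep : P.Separable := by
    have h1 : (minpoly ℚ β).Separable := (minpoly.irreducible hβ.tower_top).separable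
    have h2 : P = (minpoly ℚ β).map (algebraMap ℚ ℝ) := by
      rw [minpoly.isIntegrallyClosed_eq_field_fractions' ℚ hβ, Polynomial.map_map, hP]
      congr 1
    rw [h2]
    exact h1.map
  obtain ⟨r, hr⟩ := minpoly.dvd ℝ α hα0
  have hcop : IsCoprime (minpoly ℝ α) r := Separable.isCoprime (hr ▸ hsep)
  have hann := aeval_companionMap β hβ
  rw [← hP, hr] at hann
  have hrange : invComplement β α = LinearMap.ker (aeval (companionMap β) r) := by
    apply le_antisymm
    · rintro _ ⟨v, rfl⟩
      rw [LinearMap.mem_ker, ← Module.End.mul_apply, ← aeval_mul, mul_comm, hann,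
        LinearMap.zero_apply]
    · intro v hv
      obtain ⟨a, b, hab⟩ := hcop
      refine ⟨aeval (companionMap β) a v, ?_⟩
      have h := congr_arg (fun p : ℝ[X] => aeval (companionMap β) p v) hab
      simp only [map_add, aeval_mul, LinearMap.add_apply, Module.End.mul_apply,
        LinearMap.mem_ker.1 hv, map_zero, add_zero, aeval_one, Module.End.one_apply] at h
      rw [← Module.End.mul_apply, ← aeval_mul, mul_comm, aeval_mul, Module.End.mul_apply, h]
  rw [hrange]
  refine ⟨disjoint_ker_aeval_of_isCoprime _ hcop, codisjoint_iff.2 ?_⟩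
  change LinearMap.ker _ ⊔ LinearMap.ker _ = ⊤
  rw [sup_ker_aeval_eq_ker_aeval_mul_of_coprime _ hcop, hann, LinearMap.ker_zero]

/-- On the invariant subspace attached to the conjugate `α` of `β`, the companion map is a
similarity of ratio `|α|`. -/
theorem normF_companionMap (β : ℝ) (hβ : IsIntegral ℤ β) (α : ℂ)
    (hα : α ∈ (minpoly ℤ β).aroots ℂ) (v : Space β) (hv : v ∈ invSubspace β α) :
    normF β α (companionMap β v) = ‖α‖ * normF β α v := by
  unfold normF
  split_ifs with h
  · have hre : α = algebraMap ℝ ℂ α.re := by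
      apply Complex.ext <;> simp [h]
    have hmin : minpoly ℝ α = X - C α.re := by
      conv_lhs => rw [hre]
      exact minpoly.eq_X_sub_C_of_algebraMap_inj _ (algebraMap ℝ ℂ).injective
    rw [invSubspace, hmin, LinearMap.mem_ker] at hv
    simp only [map_sub, aeval_X, aeval_C, LinearMap.sub_apply, Module.algebraMap_end_apply,
      sub_eq_zero] at hv
    rw [hv, norm_smul, hre]
    simp
  · rw [coord_companionMap β hβ α (mem_aroots.1 hα).2, norm_mul]

end BetaExpansion

end

/-!
# The degree of the Parry polynomial of a Pisot number

The lattice `ℤ^d` is identified with `ℤ[β]` through `x ↦ ∑ x_j β^j`, so that `π_B(x) · u_B` is the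
value of `x` divided by `‖B‖`, and `ᵗQ` is the multiplication by `β`. The iterates of `1` under the
`β`-transformation are `T_β^n(1) = R_n(β)` (`aeval_remainderPoly`), where the coefficients of `R_n`
have modulus at most `⌊β⌋`; `polyPoint β (R_n)` is the lattice point representing `R_n(β)`, that is,
`R_n(ᵗQ) Z_0`.

All these points project into the window `Ω'`. Indeed, cut `R_n(ᵗQ) Z_0` into blocks of `d`
consecutive powers of `ᵗQ`: each block is a point of `⌊β⌋ 𝒞'` moved by a power of `(ᵗQ)^d`. As
`(ᵗQ)^d` contracts `F` by the factor `λ_F^d`, the norms of the projections of the blocks on `F` are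
bounded by a geometric series with sum `c'_F` (`normF_projF_sum_le`, `normF_projF_polyPoint_le`).

A lattice point of a bounded strip that projects into a dilation of `Ω'` has bounded values at all
the conjugates of `β`; as these values determine the point linearly, there are only finitely many
such points (`finite_latticePoint_window`). Hence the orbit of `1` is finite, and `β` is a Parry
number (`IsPisot.isParry`).

By minimality of the preperiod and period lengths, or of the length of a finite expansion, the
iterates `T_β^n(1)` with `n < d_P` are pairwise distinct and non-zero
(`exists_natDegree_le_and_orbit_injective`). For `1 ≤ n < d_P` they lie in `[0, 1)`, and together
with the origin they give `d_P` points of the cut-and-project set: the dilation factor of the window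
is at least `1`, because `⌊β⌋ = t₁` is, up to sign, a coefficient of the Parry polynomial, or one
less than a coefficient when the period length is `1` (`floor_le_supNorm_parryPoly`).
-/

namespace BetaExpansion

open Polynomial

/-! ### The orbit of `1` and its digits -/

theorem betaT_iterate_mem_Icc (β : ℝ) (n : ℕ) : (betaT β)^[n] 1 ∈ Set.Icc (0 : ℝ) 1 := by
  cases n with
  | zero => simp
  | succ n =>
    rw [Function.iterate_succ_apply']
    exact ⟨Int.fract_nonneg _, (Int.fract_lt_one _).le⟩

theorem betaT_iterate_lt_one (β : ℝ) {n : ℕ} (hn : 0 < n) : (betaT β)^[n] 1 < 1 := by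
  obtain ⟨k, rfl⟩ := Nat.exists_eq_succ_of_ne_zero hn.ne'
  rw [Function.iterate_succ_apply']
  exact Int.fract_lt_one _

theorem digit_nonneg {β : ℝ} (hβ : 1 < β) (n : ℕ) : 0 ≤ digit β n :=
  Int.floor_nonneg.2 (mul_nonneg (by linarith) (betaT_iterate_mem_Icc β n).1)

theorem digit_le_floor {β : ℝ} (hβ : 1 < β) (n : ℕ) : digit β n ≤ ⌊β⌋ :=
  Int.floor_le_floor (mul_le_of_le_one_right (by linarith) (betaT_iterate_mem_Icc β n).2)

theorem digit_zero (β : ℝ) : digit β 0 = ⌊β⌋ := by simp [digit]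

theorem one_le_floor {β : ℝ} (hβ : 1 < β) : 1 ≤ ⌊β⌋ := Int.le_floor.2 (by simpa using hβ.le)

theorem digit_eq_of_iterate_eq {β : ℝ} {i j : ℕ} (h : (betaT β)^[i] 1 = (betaT β)^[j] 1) (k : ℕ) :
    digit β (i + k) = digit β (j + k) := by
  unfold digit
  rw [add_comm i, add_comm j, Function.iterate_add_apply, h, ← Function.iterate_add_apply]

/-- A collision in the orbit of `1` makes the digits periodic from then on. -/
theorem digit_add_sub_of_iterate_eq {β : ℝ} {i j : ℕ} (hij : i < j)
    (h : (betaT β)^[i] 1 = (betaT β)^[j] 1) {n : ℕ} (hn : i ≤ n) :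
    digit β (n + (j - i)) = digit β n := by
  have := digit_eq_of_iterate_eq h (n - i)
  rw [show i + (n - i) = n by omega] at this
  rw [this]
  congr 1
  omega

theorem isParry_of_iterate_eq {β : ℝ} {i j : ℕ} (hij : i < j)
    (h : (betaT β)^[i] 1 = (betaT β)^[j] 1) : IsParry β :=
  ⟨i, j - i, by omega, fun _ hn => digit_add_sub_of_iterate_eq hij h hn⟩

theorem digit_add_mul {β : ℝ} {m q : ℕ} (h : ∀ i, m ≤ i → digit β (i + q) = digit β i)
    {n : ℕ} (hn : m ≤ n) (k : ℕ) : digit β (n + k * q) = digit β n := by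
  induction k with
  | zero => simp
  | succ k ih => rw [add_mul, one_mul, ← add_assoc, h _ (by omega), ih]

theorem digit_eq_zero_of_iterate_eq_zero {β : ℝ} {i : ℕ} (h : (betaT β)^[i] 1 = 0) {n : ℕ}
    (hn : i ≤ n) : digit β n = 0 := by
  obtain ⟨k, rfl⟩ := Nat.exists_eq_add_of_le' hn
  have h0 : betaT β 0 = 0 := by simp [betaT]
  rw [digit, Function.iterate_add_apply, h, Function.iterate_fixed h0]
  simp

/-! ### The polynomials of the orbit -/

theorem remainderPoly_coeff (β : ℝ) (n k : ℕ) :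
    (remainderPoly β n).coeff k =
      if k = n then 1 else if k < n then -digit β (n - 1 - k) else 0 := by
  have hsum : (∑ i ∈ Finset.range n, C (digit β i) * X ^ (n - 1 - i)).coeff k =
      if k < n then digit β (n - 1 - k) else 0 := by
    simp only [finsetSum_coeff, coeff_C_mul, coeff_X_pow]
    split_ifs with hk
    · rw [Finset.sum_eq_single (n - 1 - k)]
      · rw [if_pos (by omega), mul_one]
      · intro i hi hne
        rw [Finset.mem_range] at hi
        rw [if_neg (by omega), mul_zero]
      · intro h
        exact absurd (Finset.mem_range.2 (by omega)) h
    · refine Finset.sum_eq_zero fun i hi => ?_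
      rw [Finset.mem_range] at hi
      rw [if_neg (by omega), mul_zero]
  rw [remainderPoly, coeff_sub, hsum, coeff_X_pow]
  split_ifs <;> omega

theorem natDegree_remainderPoly_le (β : ℝ) (n : ℕ) : (remainderPoly β n).natDegree ≤ n :=
  natDegree_le_iff_coeff_eq_zero.2 fun k hk => by
    rw [remainderPoly_coeff, if_neg (by omega), if_neg (by omega)]

theorem abs_remainderPoly_coeff_le {β : ℝ} (hβ : 1 < β) (n k : ℕ) :
    |(remainderPoly β n).coeff k| ≤ ⌊β⌋ := by
  have h1 := one_le_floor hβ
  rw [remainderPoly_coeff]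
  split_ifs
  · simpa using h1
  · rw [abs_neg, abs_of_nonneg (digit_nonneg hβ _)]
    exact digit_le_floor hβ _
  · simpa using by omega

theorem remainderPoly_succ (β : ℝ) (n : ℕ) :
    remainderPoly β (n + 1) = X * remainderPoly β n - C (digit β n) := by
  ext k
  cases k with
  | zero => simp [remainderPoly_coeff]
  | succ k =>
    rw [coeff_sub, coeff_X_mul, coeff_C_succ, sub_zero, remainderPoly_coeff, remainderPoly_coeff,
      show n + 1 - 1 - (k + 1) = n - 1 - k by omega]
    simp

/-- The orbit of `1` consists of the values at `β` of the remainder polynomials. -/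
theorem aeval_remainderPoly (β : ℝ) (n : ℕ) :
    aeval β (remainderPoly β n) = (betaT β)^[n] 1 := by
  induction n with
  | zero => simp [remainderPoly]
  | succ n ih =>
    rw [remainderPoly_succ, map_sub, map_mul, aeval_X, ih, Function.iterate_succ_apply', betaT,
      digit, Int.fract]
    simp

/-! ### The Parry polynomial -/

theorem natDegree_parryPoly_le_of_isSimpleParry {β : ℝ} (h : IsSimpleParry β) :
    (parryPoly β).natDegree ≤ expansionLength β := by
  rw [parryPoly, if_pos h]
  exact natDegree_remainderPoly_le _ _

theorem natDegree_parryPoly_le_of_not_isSimpleParry {β : ℝ} (h : ¬ IsSimpleParry β) :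
    (parryPoly β).natDegree ≤ preperiod β + period β := by
  rw [parryPoly, if_neg h]
  exact (natDegree_sub_le _ _).trans (max_le (natDegree_remainderPoly_le _ _)
    ((natDegree_remainderPoly_le _ _).trans (Nat.le_add_right _ _)))

theorem digit_of_expansionLength_le {β : ℝ} (h : IsSimpleParry β) {i : ℕ}
    (hi : expansionLength β ≤ i) : digit β i = 0 :=
  Nat.sInf_mem (s := {n | ∀ i, n ≤ i → digit β i = 0}) h i hi

theorem one_le_expansionLength {β : ℝ} (hβ : 1 < β) (h : IsSimpleParry β) :
    1 ≤ expansionLength β := by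
  by_contra! h0
  have h1 := digit_of_expansionLength_le (i := 0) h (by omega)
  have h2 := one_le_floor hβ
  rw [digit_zero] at h1
  omega

theorem one_le_period_and_digit_add_period {β : ℝ} (h : IsParry β) :
    1 ≤ period β ∧ ∀ i, preperiod β ≤ i → digit β (i + period β) = digit β i :=
  Nat.sInf_mem (s := {q | 1 ≤ q ∧ ∀ i, preperiod β ≤ i → digit β (i + q) = digit β i})
    (Nat.sInf_mem (s := {n | ∃ q, 1 ≤ q ∧ ∀ i, n ≤ i → digit β (i + q) = digit β i}) h)

/-- The second coefficient of the Parry polynomial is `-t₁`, or `-t₁ - 1` when the period length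
is `1`; and `t₁ = ⌊β⌋`. -/
theorem floor_le_supNorm_parryPoly {β : ℝ} (hβ : 1 < β) (h : IsParry β) :
    (⌊β⌋ : ℝ) ≤ (parryPoly β).supNorm := by
  have h1 := one_le_floor hβ
  suffices ∃ k, ⌊β⌋ ≤ |(parryPoly β).coeff k| by
    obtain ⟨k, hk⟩ := this
    refine le_trans ?_ ((parryPoly β).le_supNorm k)
    rw [Int.norm_eq_abs]
    exact_mod_cast hk
  by_cases hs : IsSimpleParry β
  · have hm := one_le_expansionLength hβ hs
    refine ⟨expansionLength β - 1, ?_⟩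
    rw [parryPoly, if_pos hs, remainderPoly_coeff, if_neg (by omega), if_pos (by omega),
      Nat.sub_self, digit_zero, abs_neg]
    exact le_abs_self _
  · have hq := (one_le_period_and_digit_add_period h).1
    refine ⟨preperiod β + period β - 1, ?_⟩
    rw [parryPoly, if_neg hs, coeff_sub, remainderPoly_coeff, if_neg (by omega),
      if_pos (by omega), Nat.sub_self, digit_zero, remainderPoly_coeff]
    have hnot : ¬ preperiod β + period β - 1 < preperiod β := by omega
    rw [if_neg hnot]
    split_ifs
    · rw [show -⌊β⌋ - 1 = -(⌊β⌋ + 1) by ring, abs_neg]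
      exact le_trans (by omega) (le_abs_self _)
    · rw [sub_zero, abs_neg]
      exact le_abs_self _

/-- Before the time `m` (for a finite expansion of length `m`) or `m + q` (for preperiod `m` and
period `q`), which bounds the degree of the Parry polynomial, the orbit of `1` neither vanishes nor
repeats itself: otherwise one of the least lengths `m`, `q` could be decreased. -/
theorem exists_natDegree_le_and_orbit_injective {β : ℝ} (h : IsParry β) :
    ∃ N, (parryPoly β).natDegree ≤ N ∧ (∀ i, i < N → (betaT β)^[i] 1 ≠ 0) ∧
      ∀ i j, i < j → j < N → (betaT β)^[i] 1 ≠ (betaT β)^[j] 1 := by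
  by_cases hs : IsSimpleParry β
  · have hmin : ∀ i, i < expansionLength β → ¬ ∀ n, i ≤ n → digit β n = 0 := fun i hi hz =>
      absurd (Nat.sInf_le (s := {n | ∀ i, n ≤ i → digit β i = 0}) hz) (not_le.2 hi)
    refine ⟨_, natDegree_parryPoly_le_of_isSimpleParry hs,
      fun i hi h0 => hmin i hi fun n hn => digit_eq_zero_of_iterate_eq_zero h0 hn,
      fun i j hij hj heq => hmin i (hij.trans hj) fun n hn => ?_⟩
    rw [← digit_add_mul (fun k hk => digit_add_sub_of_iterate_eq hij heq hk) hn
      (expansionLength β)]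
    refine digit_of_expansionLength_le hs ?_
    have := Nat.le_mul_of_pos_right (expansionLength β) (show 0 < j - i by omega)
    omega
  · obtain ⟨hq, hper⟩ := one_le_period_and_digit_add_period h
    refine ⟨_, natDegree_parryPoly_le_of_not_isSimpleParry hs,
      fun i _ h0 => hs ⟨i, fun n hn => digit_eq_zero_of_iterate_eq_zero h0 hn⟩,
      fun i j hij hj heq => ?_⟩
    have hperi : ∀ n, i ≤ n → digit β (n + (j - i)) = digit β n :=
      fun n hn => digit_add_sub_of_iterate_eq hij heq hn
    have hm : preperiod β ≤ i :=
      Nat.sInf_le (s := {n | ∃ q, 1 ≤ q ∧ ∀ i, n ≤ i → digit β (i + q) = digit β i})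
        ⟨j - i, by omega, hperi⟩
    -- The period `j - i` holds from `i` on, hence from the preperiod on, by shifting far to the
    -- right by a multiple of the least period.
    have hle : period β ≤ j - i :=
      Nat.sInf_le (s := {q | 1 ≤ q ∧ ∀ i, preperiod β ≤ i → digit β (i + q) = digit β i}) <| by
        refine ⟨by omega, fun n hn => ?_⟩
        have := Nat.le_mul_of_pos_right i (show 0 < period β by omega)
        rw [← digit_add_mul hper (n := n + (j - i)) (by omega) i, ← digit_add_mul hper hn i,
          ← hperi (n + i * period β) (by omega)]
        congr 1
        omega
    omega

/-! ### Evaluation of vectors at the conjugates -/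

/-- The evaluation `v ↦ ∑ v_j z^j` of a vector, seen as a polynomial of degree `< d`, at a complex
number. -/
noncomputable def evalForm (β : ℝ) (z : ℂ) : Space β →ₗ[ℝ] ℂ where
  toFun v := ∑ j, ((v j : ℝ) : ℂ) * z ^ (j : ℕ)
  map_add' v w := by simp [add_mul, Finset.sum_add_distrib]
  map_smul' r v := by simp [Finset.mul_sum, mul_assoc]

theorem evalForm_apply (β : ℝ) (z : ℂ) (v : Space β) :
    evalForm β z v = ∑ j, ((v j : ℝ) : ℂ) * z ^ (j : ℕ) := rfl

theorem evalForm_conj (β : ℝ) (z : ℂ) (v : Space β) :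
    evalForm β (starRingEnd ℂ z) v = starRingEnd ℂ (evalForm β z v) := by
  simp [evalForm_apply, map_sum]

theorem evalForm_ofReal (β : ℝ) (v : Space β) :
    evalForm β (β : ℂ) v = ((∑ j, v j * β ^ (j : ℕ) : ℝ) : ℂ) := by
  simp [evalForm_apply]

/-- Evaluation at a conjugate `z` turns the action of `q(ᵗQ)` into the multiplication by `q(z)`. -/
theorem evalForm_aeval_companionMap {β : ℝ} (hβ : IsIntegral ℤ β) {z : ℂ}
    (hz : z ∈ (minpoly ℤ β).aroots ℂ) (q : ℝ[X]) (v : Space β) :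
    evalForm β z (aeval (companionMap β) q v) = aeval z q * evalForm β z v := by
  have hT : ∀ w, evalForm β z (companionMap β w) = z * evalForm β z w :=
    coord_companionMap β hβ z (mem_aroots.1 hz).2
  induction q using Polynomial.induction_on' with
  | add p q hp hq => simp only [map_add, LinearMap.add_apply, hp, hq, add_mul]
  | monomial n a =>
    rw [aeval_monomial, aeval_monomial, Module.End.mul_apply, Module.algebraMap_end_apply,
      map_smul]
    have : evalForm β z ((companionMap β ^ n) v) = z ^ n * evalForm β z v := by
      induction n with
      | zero => simp
      | succ n ih => rw [pow_succ', Module.End.mul_apply, hT, ih, pow_succ', mul_assoc]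
    rw [this, Complex.real_smul, Complex.coe_algebraMap, mul_assoc]

/-- A vector is determined by its values at the `d` conjugates. -/
theorem eq_zero_of_evalForm_eq_zero {β : ℝ} (hβ : IsIntegral ℤ β) {v : Space β}
    (hv : ∀ z ∈ (minpoly ℤ β).aroots ℂ, evalForm β z v = 0) : v = 0 := by
  classical
  have hd : 0 < deg β := minpoly.natDegree_pos hβ
  have hinj : Function.Injective (algebraMap ℤ ℂ) := (algebraMap ℤ ℂ).injective_int
  have hnodup : ((minpoly ℤ β).aroots ℂ).Nodup := by
    have h1 : (minpoly ℚ β).Separable := (minpoly.irreducible hβ.tower_top).separable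
    have h2 : (minpoly ℤ β).map (algebraMap ℤ ℂ) = (minpoly ℚ β).map (algebraMap ℚ ℂ) := by
      rw [minpoly.isIntegrallyClosed_eq_field_fractions' ℚ hβ, Polynomial.map_map]
      congr 1
    rw [aroots_def, h2]
    exact nodup_roots h1.map
  have hcard : ((minpoly ℤ β).aroots ℂ).toFinset.card = deg β := by
    rw [Multiset.toFinset_card_of_nodup hnodup, aroots_def,
      ← (IsAlgClosed.splits _).natDegree_eq_card_roots, natDegree_map_eq_of_injective hinj, deg]
  set p : ℂ[X] := ∑ j : Fin (deg β), C ((v j : ℝ) : ℂ) * X ^ (j : ℕ) with hp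
  have hp0 : p = 0 := by
    refine eq_zero_of_natDegree_lt_card_of_eval_eq_zero' p ((minpoly ℤ β).aroots ℂ).toFinset
      (fun z hz => ?_) ?_
    · rw [hp, eval_finsetSum]
      simpa [evalForm_apply] using hv z (Multiset.mem_toFinset.1 hz)
    · rw [hcard]
      refine lt_of_le_of_lt (natDegree_sum_le_of_forall_le (n := deg β - 1) _ _ fun j _ => ?_)
        (by omega)
      exact (natDegree_C_mul_X_pow_le _ _).trans (by omega)
  ext i
  have h := congrArg (fun p : ℂ[X] => p.coeff i) hp0
  simp only [hp, finsetSum_coeff, coeff_C_mul, coeff_X_pow, coeff_zero, Fin.val_inj] at h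
  simpa using h

/-- A set of lattice points on which the values at all conjugates are bounded is finite. -/
theorem finite_of_evalForm_bounded {β : ℝ} (hβ : IsIntegral ℤ β) {S : Set (Fin (deg β) → ℤ)}
    (hS : ∀ z ∈ (minpoly ℤ β).aroots ℂ, ∃ M, ∀ x ∈ S, ‖evalForm β z (latticePoint β x)‖ ≤ M) :
    S.Finite := by
  classical
  let R := ((minpoly ℤ β).aroots ℂ).toFinset
  let Φ : Space β →ₗ[ℝ] (R → ℂ) := LinearMap.pi fun z => evalForm β z
  have hker : LinearMap.ker Φ = ⊥ := by
    refine LinearMap.ker_eq_bot'.2 fun v hv => eq_zero_of_evalForm_eq_zero hβ fun z hz => ?_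
    exact congrFun hv ⟨z, Multiset.mem_toFinset.2 hz⟩
  obtain ⟨K, -, hK⟩ := Φ.exists_antilipschitzWith hker
  choose! M hM using hS
  let N : ℝ := ∑ z ∈ R, |M z|
  have hbound : ∀ x ∈ S, ∀ j, |(x j : ℝ)| ≤ K * N := by
    intro x hx j
    have h1 : ‖latticePoint β x‖ ≤ K * ‖Φ (latticePoint β x)‖ := by
      simpa using hK.le_mul_dist (latticePoint β x) 0
    have h2 : ‖Φ (latticePoint β x)‖ ≤ N := by
      refine (pi_norm_le_iff_of_nonneg (Finset.sum_nonneg fun _ _ => abs_nonneg _)).2 fun z => ?_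
      refine (hM z (Multiset.mem_toFinset.1 z.2) x hx).trans ((le_abs_self _).trans ?_)
      exact Finset.single_le_sum (f := fun z => |M z|) (fun _ _ => abs_nonneg _) z.2
    have h3 : ‖latticePoint β x j‖ ≤ ‖latticePoint β x‖ := PiLp.norm_apply_le _ j
    have h4 : |(x j : ℝ)| ≤ ‖latticePoint β x‖ := h3
    exact h4.trans (h1.trans (mul_le_mul_of_nonneg_left h2 K.2))
  refine (Set.finite_Icc (fun _ => -⌈(K : ℝ) * N⌉) (fun _ => ⌈(K : ℝ) * N⌉)).subset fun x hx => ?_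
  have h : ∀ j, |x j| ≤ ⌈(K : ℝ) * N⌉ := fun j => by
    have := (hbound x hx j).trans (Int.le_ceil _)
    exact_mod_cast this
  exact ⟨fun j => (abs_le.1 (h j)).1, fun j => (abs_le.1 (h j)).2⟩

/-! ### The projections on the invariant subspaces -/

theorem mem_innerConj {β : ℝ} {α : ℂ} :
    α ∈ innerConj β ↔ α ∈ (minpoly ℤ β).aroots ℂ ∧ α ≠ β ∧ 0 ≤ α.im := by
  simp only [innerConj, Finset.mem_filter, Multiset.mem_toFinset]

theorem norm_lt_one_of_mem_innerConj {β : ℝ} (hβ : IsPisot β) {α : ℂ} (hα : α ∈ innerConj β) :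
    ‖α‖ < 1 :=
  hβ.2.2 α (mem_innerConj.1 hα).1 (mem_innerConj.1 hα).2.1

theorem projF_mem {β : ℝ} {α : ℂ} (v : Space β) : projF β α v ∈ invSubspace β α := by
  unfold projF
  split_ifs with h
  · exact Submodule.projection_apply_mem h v
  · exact zero_mem _

theorem sub_projF_mem {β : ℝ} (hβ : IsIntegral ℤ β) {α : ℂ}
    (hα : α ∈ (minpoly ℤ β).aroots ℂ) (v : Space β) : v - projF β α v ∈ invComplement β α := by
  have h := isCompl_invSubspace β hβ α hα
  rw [projF, dif_pos h, ← Submodule.projection_apply_eq_zero_iff h, map_sub,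
    Submodule.projection_apply_of_mem_left h (Submodule.projection_apply_mem h v), sub_self]

theorem projF_companionMap {β : ℝ} (hβ : IsIntegral ℤ β) {α : ℂ}
    (hα : α ∈ (minpoly ℤ β).aroots ℂ) (v : Space β) :
    projF β α (companionMap β v) = companionMap β (projF β α v) := by
  have h := isCompl_invSubspace β hβ α hα
  have hcomm : ∀ w, aeval (companionMap β) (minpoly ℝ α) (companionMap β w) =
      companionMap β (aeval (companionMap β) (minpoly ℝ α) w) := by
    intro w
    have hX := congrArg (aeval (companionMap β)) (mul_comm (minpoly ℝ α) X)
    rw [aeval_mul, aeval_mul, aeval_X] at hX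
    exact LinearMap.congr_fun hX w
  have h1 : companionMap β (projF β α v) ∈ invSubspace β α := by
    rw [invSubspace, LinearMap.mem_ker, hcomm, LinearMap.mem_ker.1 (projF_mem v), map_zero]
  have h2 : companionMap β (v - projF β α v) ∈ invComplement β α := by
    obtain ⟨w, hw⟩ := sub_projF_mem hβ hα v
    exact ⟨companionMap β w, by rw [hcomm, hw]⟩
  have h3 : projF β α = (invSubspace β α).projection (invComplement β α) h := dif_pos h
  have h4 := Submodule.projection_apply_of_mem_left h h1
  have h5 := Submodule.projection_apply_of_mem_right h h2
  rw [← h3] at h4 h5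
  rw [map_sub, map_sub, h4, sub_eq_zero] at h5
  exact h5

/-- The evaluation at `α` kills the invariant complement of `F_α`, as the minimal polynomial of `α`
over `ℝ` vanishes at `α`. -/
theorem evalForm_projF {β : ℝ} (hβ : IsIntegral ℤ β) {α : ℂ}
    (hα : α ∈ (minpoly ℤ β).aroots ℂ) (v : Space β) :
    evalForm β α (projF β α v) = evalForm β α v := by
  obtain ⟨w, hw⟩ := sub_projF_mem hβ hα v
  rw [eq_comm, ← sub_eq_zero, ← map_sub, ← hw, evalForm_aeval_companionMap hβ hα,
    minpoly.aeval, zero_mul]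

/-- Two complex numbers of the closed upper half plane with the same minimal polynomial over `ℝ` are
equal; so distinct elements of `innerConj β` give distinct invariant subspaces. -/
theorem aeval_minpoly_ne_zero {α γ : ℂ} (hα : 0 ≤ α.im) (hγ : 0 ≤ γ.im) (hne : α ≠ γ) :
    aeval α (minpoly ℝ γ) ≠ 0 := by
  intro h0
  have hq : ∀ z : ℂ, aeval z (X ^ 2 - C (2 * γ.re) * X + C (Complex.normSq γ) : ℝ[X]) =
      (z - γ) * (z - starRingEnd ℂ γ) := by
    intro z
    have h1 : (2 * γ.re : ℂ) = γ + starRingEnd ℂ γ := by rw [Complex.add_conj]; push_cast; ring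
    have h2 : (Complex.normSq γ : ℂ) = γ * starRingEnd ℂ γ := (Complex.mul_conj γ).symm
    simp only [map_add, map_sub, map_mul, map_pow, aeval_X, aeval_C, Complex.coe_algebraMap]
    rw [h2]
    push_cast
    rw [h1]
    ring
  obtain ⟨r, hr⟩ := minpoly.dvd ℝ γ (by rw [hq, sub_self, zero_mul] :
    aeval γ (X ^ 2 - C (2 * γ.re) * X + C (Complex.normSq γ) : ℝ[X]) = 0)
  have h := hq α
  rw [hr, map_mul, h0, zero_mul, eq_comm, mul_eq_zero, sub_eq_zero, sub_eq_zero] at h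
  rcases h with h | h
  · exact hne h
  · have him := congrArg Complex.im h
    rw [Complex.conj_im] at him
    refine hne (Complex.ext ?_ (by linarith))
    simpa using congrArg Complex.re h

theorem evalForm_eq_zero_of_mem_invSubspace {β : ℝ} (hβ : IsIntegral ℤ β) {α γ : ℂ}
    (hα : α ∈ innerConj β) (hγ : γ ∈ innerConj β) (hne : α ≠ γ) {w : Space β}
    (hw : w ∈ invSubspace β γ) : evalForm β α w = 0 := by
  have hα' := mem_innerConj.1 hα
  have h := evalForm_aeval_companionMap hβ hα'.1 (minpoly ℝ γ) w
  rw [LinearMap.mem_ker.1 hw, map_zero, eq_comm, mul_eq_zero] at h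
  exact h.resolve_left (aeval_minpoly_ne_zero hα'.2.2 (mem_innerConj.1 hγ).2.2 hne)

theorem evalForm_sum {β : ℝ} (hβ : IsIntegral ℤ β) {α : ℂ} (hα : α ∈ innerConj β)
    {w : ℂ → Space β} (hw : ∀ γ ∈ innerConj β, w γ ∈ invSubspace β γ) :
    evalForm β α (∑ γ ∈ innerConj β, w γ) = evalForm β α (w α) := by
  rw [map_sum]
  exact Finset.sum_eq_single_of_mem α hα fun γ hγ hne =>
    evalForm_eq_zero_of_mem_invSubspace hβ hα hγ hne.symm (hw γ hγ)

theorem evalForm_internalProj {β : ℝ} (hβ : IsIntegral ℤ β) {α : ℂ} (hα : α ∈ innerConj β)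
    (v : Space β) : evalForm β α (internalProj β v) = evalForm β α v := by
  rw [internalProj, LinearMap.sum_apply, evalForm_sum hβ hα fun γ _ => projF_mem v,
    evalForm_projF hβ (mem_innerConj.1 hα).1]

/-! ### The norms and the windows -/

theorem normF_add_le (β : ℝ) (α : ℂ) (v w : Space β) :
    normF β α (v + w) ≤ normF β α v + normF β α w := by
  unfold normF
  split_ifs
  · exact norm_add_le v w
  · simp only [← evalForm_apply, map_add]
    exact norm_add_le _ _

theorem normF_smul (β : ℝ) (α : ℂ) (r : ℝ) (v : Space β) :
    normF β α (r • v) = |r| * normF β α v := by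
  unfold normF
  split_ifs
  · rw [norm_smul, Real.norm_eq_abs]
  · simp only [← evalForm_apply, map_smul]
    rw [norm_smul, Real.norm_eq_abs]

theorem normF_nonneg (β : ℝ) (α : ℂ) (v : Space β) : 0 ≤ normF β α v := by
  unfold normF
  split_ifs <;> exact norm_nonneg _

theorem continuous_normF (β : ℝ) (α : ℂ) : Continuous (normF β α) := by
  unfold normF
  split_ifs
  · exact continuous_norm
  · exact (evalForm β α).continuous_of_finiteDimensional.norm

/-- The evaluation at `α` is controlled by the norm of `F_α`, which for a real `α` is Euclidean and
not the modulus of the evaluation. -/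
theorem exists_norm_evalForm_le_mul_normF (β : ℝ) (α : ℂ) :
    ∃ K, 0 ≤ K ∧ ∀ v, ‖evalForm β α v‖ ≤ K * normF β α v := by
  by_cases h : α.im = 0
  · refine ⟨‖(evalForm β α).toContinuousLinearMap‖, norm_nonneg _, fun v => ?_⟩
    rw [normF, if_pos h]
    exact (evalForm β α).toContinuousLinearMap.le_opNorm v
  · refine ⟨1, zero_le_one, fun v => ?_⟩
    rw [normF, if_neg h, one_mul, evalForm_apply]

theorem isCompact_cube (β : ℝ) : IsCompact (cube β) := by
  have h : cube β = WithLp.toLp 2 '' Set.univ.pi fun _ : Fin (deg β) => Set.Icc (-1 : ℝ) 1 := by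
    ext x
    constructor
    · exact fun hx => ⟨WithLp.ofLp x, fun j _ => hx j, rfl⟩
    · rintro ⟨y, hy, rfl⟩ j
      exact hy j trivial
  rw [h]
  exact (isCompact_univ_pi fun _ => isCompact_Icc).image (PiLp.continuous_toLp 2 _)

theorem normF_projF_le_deltaF (β : ℝ) (α : ℂ) {x : Space β} (hx : x ∈ cube β) :
    normF β α (projF β α x) ≤ deltaF β α :=
  le_csSup ((isCompact_cube β).image ((continuous_normF β α).comp
    (projF β α).continuous_of_finiteDimensional)).bddAbove ⟨x, hx, rfl⟩

theorem normF_projF_le_mul_deltaF (β : ℝ) (α : ℂ) {b : ℝ} (hb : 0 < b) {y : Space β}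
    (hy : ∀ j, |y j| ≤ b) : normF β α (projF β α y) ≤ b * deltaF β α := by
  have hcube : b⁻¹ • y ∈ cube β := fun j => by
    rw [Set.mem_Icc, ← abs_le, PiLp.smul_apply, smul_eq_mul, abs_mul, abs_inv, abs_of_pos hb]
    exact inv_mul_le_one_of_le₀ (hy j) hb.le
  have h := normF_projF_le_deltaF β α hcube
  rw [map_smul, normF_smul, abs_inv, abs_of_pos hb] at h
  exact (inv_mul_le_iff₀ hb).1 h

/-- The basis vector `Z_0`, which represents `1 = β^0`. -/
noncomputable def baseVec {β : ℝ} (hβ : IsIntegral ℤ β) : Space β :=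
  EuclideanSpace.single ⟨0, minpoly.natDegree_pos hβ⟩ 1

theorem companionMap_pow_baseVec {β : ℝ} (hβ : IsIntegral ℤ β) (k : Fin (deg β)) :
    (companionMap β ^ (k : ℕ)) (baseVec hβ) = EuclideanSpace.single k 1 := by
  obtain ⟨k, hk⟩ := k
  induction k with
  | zero => simp [baseVec]
  | succ k ih =>
    have ih := ih (by omega)
    simp only at ih ⊢
    rw [pow_succ', Module.End.mul_apply, ih]
    ext i
    rw [companionMap_basis]
    have h1 : k + 1 ≠ deg β := by omega
    simp only [companionMatrix, Matrix.of_apply, h1, if_false, PiLp.single_apply, Fin.ext_iff]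

theorem sum_companionMap_pow_baseVec {β : ℝ} (hβ : IsIntegral ℤ β) (c : ℕ → ℝ) :
    ∑ k ∈ Finset.range (deg β), c k • (companionMap β ^ k) (baseVec hβ) =
      WithLp.toLp 2 fun j : Fin (deg β) => c j := by
  rw [← Fin.sum_univ_eq_sum_range fun k => c k • (companionMap β ^ k) (baseVec hβ)]
  simp only [companionMap_pow_baseVec]
  ext i
  simp [Finset.sum_apply, Pi.single_apply]

theorem normF_companionMap_pow {β : ℝ} (hβ : IsIntegral ℤ β) {α : ℂ}
    (hα : α ∈ (minpoly ℤ β).aroots ℂ) (n : ℕ) (v : Space β) :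
    normF β α (projF β α ((companionMap β ^ n) v)) = ‖α‖ ^ n * normF β α (projF β α v) := by
  induction n with
  | zero => simp
  | succ n ih =>
    rw [pow_succ', Module.End.mul_apply, projF_companionMap hβ hα,
      normF_companionMap β hβ α hα _ (projF_mem _), ih, pow_succ', mul_assoc]

/-- Cutting `∑ c_k (ᵗQ)^k Z_0` into blocks of length `d`, each block is a point of the dilated cube
moved by a power of `(ᵗQ)^d`; the contraction of `(ᵗQ)^d` on `F` then gives a geometric series. -/
theorem normF_projF_sum_le {β : ℝ} (hβ : IsIntegral ℤ β) {α : ℂ}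
    (hα : α ∈ (minpoly ℤ β).aroots ℂ) (hα1 : ‖α‖ < 1) {b : ℝ} (hb : 0 < b) (l : ℕ) :
    ∀ c : ℕ → ℝ, (∀ k, |c k| ≤ b) →
      normF β α (projF β α
        (∑ k ∈ Finset.range (l * deg β), c k • (companionMap β ^ k) (baseVec hβ))) ≤
      b * (deltaF β α / (1 - ‖α‖ ^ deg β)) := by
  have hd : deg β ≠ 0 := (minpoly.natDegree_pos hβ).ne'
  have hpos : 0 < 1 - ‖α‖ ^ deg β := sub_pos.2 (pow_lt_one₀ (norm_nonneg _) hα1 hd)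
  induction l with
  | zero =>
    intro c _
    have h0 : normF β α (0 : Space β) = 0 := by
      simpa using normF_smul β α 0 (0 : Space β)
    have hδ : 0 ≤ deltaF β α := (normF_nonneg β α _).trans
      (normF_projF_le_deltaF β α (x := 0) fun j => by simp)
    rw [zero_mul, Finset.range_zero, Finset.sum_empty, map_zero, h0]
    positivity
  | succ l ih =>
    intro c hc
    have hshift : ∑ k ∈ Finset.range (l * deg β),
        c (deg β + k) • (companionMap β ^ (deg β + k)) (baseVec hβ) =
        (companionMap β ^ deg β) (∑ k ∈ Finset.range (l * deg β),
          c (deg β + k) • (companionMap β ^ k) (baseVec hβ)) := by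
      rw [map_sum]
      exact Finset.sum_congr rfl fun k _ => by rw [map_smul, pow_add, Module.End.mul_apply]
    rw [add_mul, one_mul, add_comm, Finset.sum_range_add, hshift, sum_companionMap_pow_baseVec,
      map_add]
    refine (normF_add_le _ _ _ _).trans ?_
    rw [normF_companionMap_pow hβ hα]
    have h1 := normF_projF_le_mul_deltaF β α hb
      (y := WithLp.toLp 2 fun j : Fin (deg β) => c j) fun j => hc j
    have h2 := mul_le_mul_of_nonneg_left (ih (fun k => c (deg β + k)) fun k => hc _)
      (pow_nonneg (norm_nonneg α) (deg β))
    have h3 : b * deltaF β α + ‖α‖ ^ deg β * (b * (deltaF β α / (1 - ‖α‖ ^ deg β))) =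
        b * (deltaF β α / (1 - ‖α‖ ^ deg β)) := by
      field_simp
      ring
    exact (add_le_add h1 h2).trans h3.le

/-! ### Lattice points attached to integer polynomials -/

/-- The lattice point representing `p(β)`: the coordinates of the remainder of `p` modulo the
minimal polynomial of `β`. -/
noncomputable def polyPoint (β : ℝ) (p : ℤ[X]) : Fin (deg β) → ℤ :=
  fun j => (p %ₘ minpoly ℤ β).coeff j

theorem sum_polyPoint {β : ℝ} (hβ : IsIntegral ℤ β) (p : ℤ[X]) :
    ∑ j, (polyPoint β p j : ℝ) * β ^ (j : ℕ) = aeval β p := by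
  have hne : minpoly ℤ β ≠ 1 := minpoly.ne_one ℤ β
  rw [← aeval_modByMonic_eq_self_of_root (minpoly.aeval ℤ β),
    aeval_eq_sum_range' (natDegree_modByMonic_lt p (minpoly.monic hβ) hne), ← deg,
    ← Fin.sum_univ_eq_sum_range fun k => (p %ₘ minpoly ℤ β).coeff k • β ^ k]
  simp [polyPoint]

theorem latticePoint_polyPoint {β : ℝ} (hβ : IsIntegral ℤ β) (p : ℤ[X]) :
    latticePoint β (polyPoint β p) =
      aeval (companionMap β) (p.map (Int.castRingHom ℝ)) (baseVec hβ) := by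
  have hne : minpoly ℤ β ≠ 1 := minpoly.ne_one ℤ β
  have hlt := (natDegree_map_le (f := Int.castRingHom ℝ)).trans_lt
    (natDegree_modByMonic_lt p (minpoly.monic hβ) hne)
  conv_rhs => rw [← modByMonic_add_div p (minpoly ℤ β)]
  rw [Polynomial.map_add, Polynomial.map_mul, map_add, map_mul, aeval_companionMap β hβ, zero_mul,
    add_zero, aeval_eq_sum_range' hlt, LinearMap.sum_apply]
  simp only [LinearMap.smul_apply]
  rw [← deg, sum_companionMap_pow_baseVec]
  simp [latticePoint, polyPoint]

/-- A lattice point representing `p(β)`, where `p` has coefficients of modulus at most `⌊β⌋`,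
projects into every window. -/
theorem normF_projF_polyPoint_le {β : ℝ} (hβ : IsPisot β) {p : ℤ[X]}
    (hp : ∀ k, |p.coeff k| ≤ ⌊β⌋) {α : ℂ} (hα : α ∈ innerConj β) :
    normF β α (projF β α (latticePoint β (polyPoint β p))) ≤ radiusF β α := by
  have hd : 0 < deg β := minpoly.natDegree_pos hβ.1
  have hb : (0 : ℝ) < ⌊β⌋ := by exact_mod_cast one_le_floor hβ.2.1
  have hlt : (p.map (Int.castRingHom ℝ)).natDegree < (p.natDegree + 1) * deg β :=
    natDegree_map_le.trans_lt (Nat.lt_of_lt_of_le (Nat.lt_succ_self _)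
      (Nat.le_mul_of_pos_right _ hd))
  rw [latticePoint_polyPoint hβ.1, aeval_eq_sum_range' hlt, LinearMap.sum_apply]
  simp only [LinearMap.smul_apply]
  refine normF_projF_sum_le hβ.1 (mem_innerConj.1 hα).1
    (norm_lt_one_of_mem_innerConj hβ hα) hb _ _ fun k => ?_
  rw [coeff_map, eq_intCast]
  exact_mod_cast hp k

/-- The windows are star-shaped at the origin, so a dilation by a factor at least `1` enlarges them. -/
theorem internalProj_mem_smul_window {β : ℝ} {r : ℝ} (hr : 1 ≤ r) {v : Space β}
    (hv : ∀ α ∈ innerConj β, normF β α (projF β α v) ≤ radiusF β α) :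
    internalProj β v ∈ r • window β := by
  have hr0 : 0 < r := by linarith
  refine Set.mem_smul_set.2 ⟨r⁻¹ • internalProj β v,
    ⟨fun α => r⁻¹ • projF β α v, fun α hα => ⟨Submodule.smul_mem _ _ (projF_mem v), ?_⟩, ?_⟩, ?_⟩
  · rw [normF_smul, abs_of_pos (inv_pos.2 hr0)]
    exact (mul_le_of_le_one_left (normF_nonneg _ _ _) (inv_le_one_of_one_le₀ hr)).trans (hv α hα)
  · rw [internalProj, LinearMap.sum_apply, Finset.smul_sum]
  · rw [smul_smul, mul_inv_cancel₀ hr0.ne', one_smul]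

theorem inner_projB (β : ℝ) (v : Space β) :
    inner ℝ (projB β v) (unitB β) = (∑ j, v j * β ^ (j : ℕ)) / ‖vecB β‖ := by
  rw [projB, Submodule.inner_starProjection_left_eq_right,
    Submodule.starProjection_eq_self_iff.2 (Submodule.mem_span_singleton_self _), unitB,
    inner_smul_right, PiLp.inner_apply, div_eq_inv_mul]
  simp [vecB, mul_comm]

theorem norm_vecB_pos {β : ℝ} (hβ : IsIntegral ℤ β) : 0 < ‖vecB β‖ := by
  refine norm_pos_iff.2 fun h => ?_
  have := congrArg (fun v : Space β => v ⟨0, minpoly.natDegree_pos hβ⟩) h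
  simp [vecB] at this

theorem inner_projB_mem_Ico_iff {β : ℝ} (hβ : IsIntegral ℤ β) (v : Space β) :
    inner ℝ (projB β v) (unitB β) ∈ Set.Ico 0 (1 / ‖vecB β‖) ↔
      ∑ j, v j * β ^ (j : ℕ) ∈ Set.Ico (0 : ℝ) 1 := by
  have h := norm_vecB_pos hβ
  rw [inner_projB, Set.mem_Ico, Set.mem_Ico, div_lt_div_iff_of_pos_right h, le_div_iff₀ h,
    zero_mul]

/-! ### Finiteness and membership -/

/-- A dilated window bounds the values of a lattice point at the conjugates of the closed upper half
plane, complex conjugation those at the others, and the strip the value at `β`. -/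
theorem finite_latticePoint_window {β : ℝ} (hβ : IsIntegral ℤ β) (r : ℝ) :
    {x : Fin (deg β) → ℤ | internalProj β (latticePoint β x) ∈ r • window β ∧
      ∑ j, (x j : ℝ) * β ^ (j : ℕ) ∈ Set.Icc (0 : ℝ) 1}.Finite := by
  have hinner : ∀ α ∈ innerConj β, ∃ M, ∀ v : Space β, internalProj β v ∈ r • window β →
      ‖evalForm β α v‖ ≤ M := by
    intro α hα
    obtain ⟨K, hK0, hK⟩ := exists_norm_evalForm_le_mul_normF β α
    refine ⟨|r| * (K * radiusF β α), fun v hv => ?_⟩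
    obtain ⟨_, ⟨w, hw, rfl⟩, hv⟩ := Set.mem_smul_set.1 hv
    rw [← evalForm_internalProj hβ hα, ← hv, map_smul, evalForm_sum hβ hα fun γ hγ => (hw γ hγ).1,
      norm_smul, Real.norm_eq_abs]
    exact mul_le_mul_of_nonneg_left ((hK _).trans (mul_le_mul_of_nonneg_left (hw α hα).2 hK0))
      (abs_nonneg r)
  refine finite_of_evalForm_bounded hβ fun z hz => ?_
  by_cases hzβ : z = β
  · refine ⟨1, fun x hx => ?_⟩
    rw [hzβ, evalForm_ofReal, Complex.norm_real, Real.norm_eq_abs]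
    exact abs_le.2 ⟨by linarith [hx.2.1, show ∑ j, latticePoint β x j * β ^ (j : ℕ) =
      ∑ j, (x j : ℝ) * β ^ (j : ℕ) from rfl], hx.2.2⟩
  rcases le_total 0 z.im with him | him
  · obtain ⟨M, hM⟩ := hinner z (mem_innerConj.2 ⟨hz, hzβ, him⟩)
    exact ⟨M, fun x hx => hM _ hx.1⟩
  · have hconj : starRingEnd ℂ z ∈ innerConj β := by
      refine mem_innerConj.2 ⟨mem_aroots.2 ⟨(mem_aroots.1 hz).1, ?_⟩, fun h => hzβ ?_,
        by simpa using him⟩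
      · have h := aeval_algHom_apply ((starRingEnd ℂ).toIntAlgHom) z (minpoly ℤ β)
        rw [(mem_aroots.1 hz).2, map_zero] at h
        exact h
      · rw [← Complex.conj_conj z, h, Complex.conj_ofReal]
    obtain ⟨M, hM⟩ := hinner _ hconj
    refine ⟨M, fun x hx => ?_⟩
    have := hM _ hx.1
    rwa [evalForm_conj, RCLike.norm_conj] at this

/-- A Pisot number is a Parry number: the infinitely many iterates `T_β^n(1)` are represented by
lattice points of a finite set, so two of them coincide. -/
theorem IsPisot.isParry {β : ℝ} (hβ : IsPisot β) : IsParry β := by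
  have hmem : ∀ n, polyPoint β (remainderPoly β n) ∈
      {x : Fin (deg β) → ℤ | internalProj β (latticePoint β x) ∈ (1 : ℝ) • window β ∧
        ∑ j, (x j : ℝ) * β ^ (j : ℕ) ∈ Set.Icc (0 : ℝ) 1} := fun n =>
    ⟨internalProj_mem_smul_window le_rfl fun _ hα =>
      normF_projF_polyPoint_le hβ (abs_remainderPoly_coeff_le hβ.2.1 n) hα, by
      rw [sum_polyPoint hβ.1, aeval_remainderPoly]
      exact betaT_iterate_mem_Icc β n⟩
  obtain ⟨i, -, j, -, hne, heq⟩ := Set.infinite_univ.exists_ne_map_eq_of_mapsTo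
    (f := fun n => polyPoint β (remainderPoly β n)) (fun n _ => hmem n)
    (finite_latticePoint_window hβ.1 1)
  have h : (betaT β)^[i] 1 = (betaT β)^[j] 1 := by
    rw [← aeval_remainderPoly, ← aeval_remainderPoly, ← sum_polyPoint hβ.1, ← sum_polyPoint hβ.1]
    exact Finset.sum_congr rfl fun k _ => by
      rw [show polyPoint β _ k = polyPoint β _ k from congrFun heq k]
  rcases hne.lt_or_gt with hij | hij
  · exact isParry_of_iterate_eq hij h
  · exact isParry_of_iterate_eq hij h.symm

theorem finite_cutPoints {β : ℝ} (hβ : IsIntegral ℤ β) : (cutPoints β).Finite := by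
  refine (finite_latticePoint_window hβ ((parryPoly β).supNorm / (⌊β⌋ : ℝ))).subset fun x hx => ?_
  exact ⟨hx.1, Set.Ico_subset_Icc_self ((inner_projB_mem_Ico_iff hβ _).1 hx.2)⟩

/-- The height of the Parry polynomial is at least `⌊β⌋`, so a polynomial with coefficients of modulus
at most `⌊β⌋` and value in `[0, 1)` at `β` gives a point of the cut-and-project set. -/
theorem mem_cutPoints {β : ℝ} (hβ : IsPisot β) {p : ℤ[X]} (hp : ∀ k, |p.coeff k| ≤ ⌊β⌋)
    (h : aeval β p ∈ Set.Ico (0 : ℝ) 1) : polyPoint β p ∈ cutPoints β := by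
  have hb : (0 : ℝ) < ⌊β⌋ := by exact_mod_cast one_le_floor hβ.2.1
  have hr : 1 ≤ (parryPoly β).supNorm / (⌊β⌋ : ℝ) :=
    (one_le_div hb).2 (floor_le_supNorm_parryPoly hβ.2.1 hβ.isParry)
  refine ⟨internalProj_mem_smul_window hr fun _ hα => normF_projF_polyPoint_le hβ hp hα,
    (inner_projB_mem_Ico_iff hβ.1 _).2 ?_⟩
  rw [← sum_polyPoint hβ.1] at h
  exact h

end BetaExpansion

theorem mainTheorem5 (β : ℝ) (hβ : BetaExpansion.IsPisot β) (hd : 2 ≤ BetaExpansion.deg β) :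
    BetaExpansion.IsParry β ∧ (BetaExpansion.cutPoints β).Finite ∧
      (BetaExpansion.parryPoly β).natDegree ≤ (BetaExpansion.cutPoints β).ncard := by
  open BetaExpansion in
  have hfin := finite_cutPoints hβ.1
  refine ⟨hβ.isParry, hfin, ?_⟩
  obtain ⟨N, hN, hne0, hne⟩ := exists_natDegree_le_and_orbit_injective hβ.isParry
  refine hN.trans ?_
  -- The origin takes the place of `T_β^0(1) = 1`, which lies outside the strip.
  let p : ℕ → Polynomial ℤ := fun n => if n = 0 then 0 else remainderPoly β n
  have hp0 : Polynomial.aeval β (p 0) = 0 := by simp [p]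
  have hpn : ∀ n, n ≠ 0 → Polynomial.aeval β (p n) = (betaT β)^[n] 1 := fun n hn => by
    simp only [p, if_neg hn, aeval_remainderPoly]
  have hmem : ∀ n, polyPoint β (p n) ∈ cutPoints β := by
    intro n
    refine mem_cutPoints hβ (fun k => ?_) ?_
    · by_cases hn : n = 0
      · simpa [p, hn] using (zero_le_one.trans (one_le_floor hβ.2.1))
      · simpa only [p, if_neg hn] using abs_remainderPoly_coeff_le hβ.2.1 n k
    · by_cases hn : n = 0
      · rw [hn, hp0]
        simp
      · rw [hpn n hn]
        exact ⟨(betaT_iterate_mem_Icc β n).1, betaT_iterate_lt_one β (Nat.pos_of_ne_zero hn)⟩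
  have haeval : ∀ i j, i < j → j < N →
      Polynomial.aeval β (p i) ≠ Polynomial.aeval β (p j) := by
    intro i j hij hj
    rw [hpn j (by omega)]
    by_cases hi : i = 0
    · rw [hi, hp0]
      exact (hne0 j hj).symm
    · rw [hpn i hi]
      exact hne i j hij hj
  have hinj : Set.InjOn (fun n => polyPoint β (p n)) (Finset.range N : Set ℕ) := by
    intro i hi j hj hij
    rw [Finset.mem_coe, Finset.mem_range] at hi hj
    have h : Polynomial.aeval β (p i) = Polynomial.aeval β (p j) := by
      rw [← sum_polyPoint hβ.1, ← sum_polyPoint hβ.1]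
      exact Finset.sum_congr rfl fun k _ => by
        rw [show polyPoint β _ k = polyPoint β _ k from congrFun hij k]
    rcases lt_trichotomy i j with h' | h' | h'
    · exact absurd h (haeval i j h' hj)
    · exact h'
    · exact absurd h.symm (haeval j i h' hi)
  have hcard := Set.ncard_le_ncard_of_injOn (s := (Finset.range N : Set ℕ))
    (fun n => polyPoint β (p n)) (fun n _ => hmem n) hinj hfin
  rwa [Set.ncard_coe_finset, Finset.card_range] at hcard
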